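/- Let $(\Theta,\mathcal B)$ be a measurable space whose diagonal $\{(\theta,\theta'):\theta=\theta'\}$ is measurable in $\Theta\times\Theta$ (for instance a standard Borel space), let $P_0$ be a probability measure on $\Theta$ with $P_0(\{\theta\})=0$ for every $\theta\in\Theta$, let $\alpha>0$, and let $1\le u_1\le u_2$ be integers. Let $v_j\overset{\mathrm{iid}}{\sim}\mathrm{Beta}(1,\alpha)$ and $\theta_j\overset{\mathrm{iid}}{\sim}P_0$, $j\ge 1$, be two independent sequences. The eventually single-atom thinned dependent Dirichlet process with parameters $(\alpha,P_0,u_1,u_2)$ is the distribution of the pair of random probability measures $$p_g=\sum_{j\ge u_g} v_j\prod_{h=u_g}^{j-1}(1-v_h)\,\delta_{\theta_j},\qquad g=1,2 .$$ Let $(p_1,p_2)$ have this distribution, and let $n_1,n_2\ge 0$ be integers. Conditionally on $(p_1,p_2)$, let the observations $y_{1,1},\dots,y_{n_1,1},y_{1,2},\dots,y_{n_2,2}$ be independent, with $y_{i,1}\sim p_1$ and $y_{i,2}\sim p_2$. Let $K$ be the number of distinct values among all these $n_1+n_2$ observations. Then $K$ is integrable and \begin{align*} \mathbb E[K]={}&\sum_{r=1}^{n_1}(-1)^{r-1}\binom{n_1}{r}\frac{\Gamma(\alpha+1)\Gamma(r)}{\Gamma(\alpha+r)}\left(1-\left(\frac{\alpha}{\alpha+r}\right)^{u_2-u_1}\right)\\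 &+\sum_{r=0}^{n_1}\binom{n_1}{r}\left(\sum_{i=1}^{n_2+n_1-r}\frac{\alpha}{\alpha+i-1}\right)\sum_{l=0}^{r}(-1)^l\binom{r}{l}\left(\frac{\alpha}{\alpha+l+n_1-r}\right)^{u_2-u_1}. \end{align*} -/

import Mathlib

open MeasureTheory ProbabilityTheory

noncomputable section

namespace ThinnedDDP

/-- The weight of the `j`-th atom after thinning by `ℓ`:
`ω_j = v_j ℓ_j ∏_{h < j} (1 - v_h ℓ_h)`, with `ℓ_j ∈ {0, 1}` (a Boolean read as `0` or `1`).
Atoms and stick-breaking variables are indexed from `0`. -/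
def weight (ℓ : ℕ → Bool) (v : ℕ → ℝ) (j : ℕ) : ℝ :=
  v j * ((ℓ j).toNat : ℝ) * ∏ h ∈ Finset.range j, (1 - v h * ((ℓ h).toNat : ℝ))

/-- The vector `(p_g)_g` of measures `p_g = ∑_j ω_{j,g} δ_{θ_j}`, built from common stick-breaking
variables `v`, common atoms `θ` and one thinning sequence for each `g`. -/
def construct {Θ : Type*} [MeasurableSpace Θ] {G : ℕ} (ℓ : Fin G → ℕ → Bool)
    (x : (ℕ → ℝ) × (ℕ → Θ)) : Fin G → Measure Θ :=
  fun g => Measure.sum fun j => ENNReal.ofReal (weight (ℓ g) x.1 j) • Measure.dirac (x.2 j)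

/-- The joint law of the inputs: `v_j` iid `Beta(1, α)` and `θ_j` iid `P₀`, the two sequences being
independent of each other. -/
def inputLaw {Θ : Type*} [MeasurableSpace Θ] (α : ℝ) (P₀ : Measure Θ) :
    Measure ((ℕ → ℝ) × (ℕ → Θ)) :=
  (Measure.infinitePi fun _ : ℕ => betaMeasure 1 α).prod (Measure.infinitePi fun _ : ℕ => P₀)

/-- The distribution thinned-DDP(`α`, `P₀`, `ℓ`) of the random vector `(p_1, …, p_G)`. -/
def law {Θ : Type*} [MeasurableSpace Θ] {G : ℕ} (α : ℝ) (P₀ : Measure Θ)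
    (ℓ : Fin G → ℕ → Bool) : Measure (Fin G → Measure Θ) :=
  (inputLaw α P₀).map (construct ℓ)

/-- `u_g - 1` zeros followed by ones, for `u_g ≥ 1`. The atom with index `j` here is the
`(j + 1)`-st one, so it is kept exactly when `u_g ≤ j + 1`. -/
def eventualThinning {G : ℕ} (u : Fin G → ℕ) : Fin G → ℕ → Bool :=
  fun g j => decide (u g ≤ j + 1)

/-- The distribution of the eventually single-atom thinned-DDP(`α`, `P₀`, `u`). -/
def eventuallySingleAtomLaw {Θ : Type*} [MeasurableSpace Θ] {G : ℕ} (α : ℝ) (P₀ : Measure Θ)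
    (u : Fin G → ℕ) : Measure (Fin G → Measure Θ) :=
  law α P₀ (eventualThinning u)

/-- Conditionally on the random vector of measures `p`, the observations `y g i` are independent,
and `y g i` has distribution `p g`: for measurable `A g i` and every event `{p ∈ C}`,
`ℙ(p ∈ C, y g i ∈ A g i for all g, i) = 𝔼[1_{p ∈ C} ∏_g ∏_i p_g (A g i)]`. -/
structure IsConditionallyIIDSample {Ω Θ : Type*} [MeasurableSpace Ω] [MeasurableSpace Θ] {G : ℕ}
    (P : Measure Ω) (p : Ω → Fin G → Measure Θ) (n : Fin G → ℕ)
    (y : (g : Fin G) → Fin (n g) → Ω → Θ) : Prop where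
  measurable : ∀ g i, Measurable (y g i)
  cond_law : ∀ A : (g : Fin G) → Fin (n g) → Set Θ, (∀ g i, MeasurableSet (A g i)) →
    ∀ C : Set (Fin G → Measure Θ), MeasurableSet C →
      P (p ⁻¹' C ∩ {ω | ∀ g i, y g i ω ∈ A g i}) =
        ∫⁻ ω in p ⁻¹' C, ∏ g, ∏ i, p ω g (A g i) ∂P

/-- `K`: the total number of distinct values in all the samples together. -/
def numDistinct {Θ : Type*} {G : ℕ} {n : Fin G → ℕ} (y : (g : Fin G) → Fin (n g) → Θ) : ℕ :=
  (⋃ g, Set.range (y g)).ncard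

/-- The construction is measurable, so that `law` is a genuine push-forward. -/
theorem measurable_construct {Θ : Type*} [MeasurableSpace Θ] {G : ℕ} (ℓ : Fin G → ℕ → Bool) :
    Measurable (construct (Θ := Θ) ℓ) := by
  refine measurable_pi_lambda _ fun g => Measure.measurable_of_measurable_coe _ fun s hs => ?_
  simp only [construct, Measure.sum_apply _ hs, Measure.smul_apply, smul_eq_mul,
    Measure.dirac_apply' _ hs]
  refine Measurable.tsum fun j => ?_
  refine Measurable.mul (ENNReal.measurable_ofReal.comp ?_) ?_
  · unfold weight
    fun_prop
  · exact (measurable_one.indicator hs).comp ((measurable_pi_apply j).comp measurable_snd)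

end ThinnedDDP

end

/-! Since `P₀` has no point masses, the atoms are a.s. distinct, so `K` counts the indices hit by
the draws. Given the weights, an index is missed with probability a product over the draws; hence
`𝔼[K]` is the sum over `k` of `𝔼[1 - (1 - ω_{k,1})^n₁ (1 - ω_{k,2})^n₂]` (`lintegral_numDistinct`).

Put `a = u₁ - 1` and `d = u₂ - u₁`. Indices below `a` carry no weight. The next `d` atoms belong to
`p₁` alone; beta moments and a geometric series give the first sum of the formula
(`sum_integral_one_sub_one_sub_stick_pow`). From `a + d` on, the weights are `W s` in `p₁` and `s`
in `p₂`, where `W` is the stick left after the `d` private breaks and is independent of `s`. Writing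
`1 - W s = (1 - W) + W (1 - s)` sorts the first sample by the number `r` of its draws falling on
private atoms; the other `n₂ + n₁ - r` draws behave as one Dirichlet process sample, with `∑ α / (α
+ i - 1)` expected distinct values. Expanding `(1 - W)^r` and using `𝔼[W^m] = (α / (α + m))^d` gives
the second sum (`hasSum_integral_one_sub_two_groups`). -/

namespace ThinnedDDP

/-! ### Moments of the beta distribution -/

section Beta

variable {α : ℝ}

lemma ae_betaMeasure_mem_Ioo (a b : ℝ) : ∀ᵐ x ∂betaMeasure a b, x ∈ Set.Ioo (0 : ℝ) 1 := by
  have hm : Measurable (betaPDF a b) := (measurable_betaPDFReal a b).ennreal_ofReal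
  rw [betaMeasure, ae_withDensity_iff hm]
  refine ae_of_all _ fun x hx => ?_
  by_contra h
  refine hx ?_
  rw [betaPDF_eq, if_neg (show ¬(0 < x ∧ x < 1) from h), ENNReal.ofReal_zero]

lemma betaPDFReal_nonneg {a b : ℝ} (ha : 0 < a) (hb : 0 < b) (x : ℝ) : 0 ≤ betaPDFReal a b x := by
  by_cases h : 0 < x ∧ x < 1
  · exact (betaPDFReal_pos h.1 h.2 ha hb).le
  · rw [betaPDFReal, if_neg h]

lemma integral_betaPDFReal {a b : ℝ} (ha : 0 < a) (hb : 0 < b) : ∫ x, betaPDFReal a b x = 1 := by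
  rw [integral_eq_lintegral_of_nonneg_ae (ae_of_all _ (betaPDFReal_nonneg ha hb))
    (measurable_betaPDFReal a b).aestronglyMeasurable]
  change (∫⁻ x, betaPDF a b x).toReal = 1
  rw [lintegral_betaPDF_eq_one ha hb, ENNReal.toReal_one]

lemma integral_betaMeasure {a b : ℝ} (ha : 0 < a) (hb : 0 < b) (f : ℝ → ℝ) :
    ∫ x, f x ∂betaMeasure a b = ∫ x, betaPDFReal a b x * f x := by
  have hm : Measurable (betaPDF a b) := (measurable_betaPDFReal a b).ennreal_ofReal
  rw [betaMeasure, integral_withDensity_eq_integral_toReal_smul hm (ae_of_all _ fun _ => ENNReal.ofReal_lt_top)]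
  refine integral_congr_ae (ae_of_all _ fun x => ?_)
  simp [betaPDF, ENNReal.toReal_ofReal (betaPDFReal_nonneg ha hb x)]

/-- The integrand times the density is the beta density with shifted parameters, up to the ratio of
normalising constants. -/
lemma integral_pow_mul_one_sub_pow_betaMeasure {a b : ℝ} (ha : 0 < a) (hb : 0 < b) (r s : ℕ) :
    ∫ x, x ^ r * (1 - x) ^ s ∂betaMeasure a b = beta (a + r) (b + s) / beta a b := by
  have har : 0 < a + r := by positivity
  have hbs : 0 < b + s := by positivity
  have h : ∀ x, betaPDFReal a b x * (x ^ r * (1 - x) ^ s)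
      = beta (a + r) (b + s) / beta a b * betaPDFReal (a + r) (b + s) x := by
    intro x
    by_cases hx : 0 < x ∧ x < 1
    · have h1 : 0 < 1 - x := by linarith [hx.2]
      have := (beta_pos ha hb).ne'
      have := (beta_pos har hbs).ne'
      rw [betaPDFReal, betaPDFReal, if_pos hx, if_pos hx,
        show a + r - 1 = (a - 1) + r by ring, show b + s - 1 = (b - 1) + s by ring,
        Real.rpow_add hx.1, Real.rpow_add h1, Real.rpow_natCast, Real.rpow_natCast]
      field_simp
    · rw [betaPDFReal, betaPDFReal, if_neg hx, if_neg hx]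
      ring
  rw [integral_betaMeasure ha hb]
  simp_rw [h]
  rw [integral_const_mul, integral_betaPDFReal har hbs, mul_one]

lemma integral_pow_betaMeasure_one (hα : 0 < α) (r : ℕ) :
    ∫ x, x ^ r ∂betaMeasure 1 α
      = Real.Gamma (α + 1) * Real.Gamma (r + 1) / Real.Gamma (α + r + 1) := by
  have h := integral_pow_mul_one_sub_pow_betaMeasure one_pos hα r 0
  simp only [pow_zero, mul_one] at h
  have h1 := (Real.Gamma_pos_of_pos hα).ne'
  have h2 := (Real.Gamma_pos_of_pos (show 0 < α + 1 by positivity)).ne'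
  have h3 := (Real.Gamma_pos_of_pos (show 0 < α + r + 1 by positivity)).ne'
  rw [h, beta, beta, Nat.cast_zero, add_zero, Real.Gamma_one, show 1 + (r : ℝ) + α = α + r + 1 by ring,
    add_comm 1 α, add_comm 1 (r : ℝ)]
  field_simp

lemma integral_one_sub_pow_betaMeasure_one (hα : 0 < α) (r : ℕ) :
    ∫ x, (1 - x) ^ r ∂betaMeasure 1 α = α / (α + r) := by
  have h := integral_pow_mul_one_sub_pow_betaMeasure one_pos hα 0 r
  simp only [pow_zero, one_mul] at h
  have h1 := (Real.Gamma_pos_of_pos hα).ne'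
  have h4 : 0 < α + r := by positivity
  have h2 := (Real.Gamma_pos_of_pos h4).ne'
  rw [h, beta, beta, Nat.cast_zero, add_zero, Real.Gamma_one, show 1 + (α + r) = (α + r) + 1 by ring,
    add_comm 1 α, Real.Gamma_add_one hα.ne', Real.Gamma_add_one h4.ne']
  field_simp

end Beta

/-! ### Algebra of stick-breaking and thinning -/

section Stick

/-- The length left over after the breaks `a, …, a + k - 1`. -/
def remainder (a k : ℕ) (v : ℕ → ℝ) : ℝ := ∏ h ∈ Finset.range k, (1 - v (a + h))

/-- The `k`-th stick-breaking weight built from `v a, v (a + 1), …`. -/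
def stick (a k : ℕ) (v : ℕ → ℝ) : ℝ := v (a + k) * remainder a k v

@[fun_prop]
lemma measurable_remainder (a k : ℕ) : Measurable (remainder a k) := by
  unfold remainder; fun_prop

@[fun_prop]
lemma measurable_stick (a k : ℕ) : Measurable (stick a k) := by
  unfold stick; fun_prop

lemma remainder_mem_Icc {v : ℕ → ℝ} (hv : ∀ j, v j ∈ Set.Icc (0 : ℝ) 1) (a k : ℕ) :
    remainder a k v ∈ Set.Icc (0 : ℝ) 1 :=
  ⟨Finset.prod_nonneg fun h _ => by linarith [(hv (a + h)).2],
    Finset.prod_le_one (fun h _ => by linarith [(hv (a + h)).2])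
      fun h _ => by linarith [(hv (a + h)).1]⟩

lemma stick_mem_Icc {v : ℕ → ℝ} (hv : ∀ j, v j ∈ Set.Icc (0 : ℝ) 1) (a k : ℕ) :
    stick a k v ∈ Set.Icc (0 : ℝ) 1 :=
  ⟨mul_nonneg (hv _).1 (remainder_mem_Icc hv a k).1,
    mul_le_one₀ (hv _).2 (remainder_mem_Icc hv a k).1 (remainder_mem_Icc hv a k).2⟩

lemma sum_stick (a n : ℕ) (v : ℕ → ℝ) :
    ∑ k ∈ Finset.range n, stick a k v = 1 - remainder a n v := by
  induction n with
  | zero => simp [remainder]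
  | succ n ih =>
    rw [Finset.sum_range_succ, ih, stick, remainder, remainder, Finset.prod_range_succ]
    ring

/-- This couples the groups: on a shared atom, the weight in `p₁` is a common factor times the
weight in `p₂`. -/
lemma stick_add (a d k : ℕ) (v : ℕ → ℝ) :
    stick a (d + k) v = remainder a d v * stick (a + d) k v := by
  simp only [stick, remainder, Finset.prod_range_add, ← add_assoc]
  ring

/-- Factors with `h < u` equal `1`, and truncated subtraction makes the right side an empty product
when `j ≤ u`. -/
lemma prod_thinned (u j : ℕ) (v : ℕ → ℝ) :
    ∏ h ∈ Finset.range j, (1 - v h * ((decide (u ≤ h) : Bool).toNat : ℝ))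
      = remainder u (j - u) v := by
  induction j with
  | zero => simp [remainder]
  | succ j ih =>
    rw [Finset.prod_range_succ, ih]
    by_cases h : u ≤ j
    · rw [Nat.sub_add_comm h, remainder, remainder, Finset.prod_range_succ, Nat.add_sub_of_le h]
      simp [h]
    · have h' : j + 1 - u = j - u := by omega
      simp [h, h']

lemma weight_of_lt {u j : ℕ} (h : j < u) (v : ℕ → ℝ) :
    weight (fun j => decide (u + 1 ≤ j + 1)) v j = 0 := by
  simp [weight, h]

lemma weight_add (u k : ℕ) (v : ℕ → ℝ) :
    weight (fun j => decide (u + 1 ≤ j + 1)) v (u + k) = stick u k v := by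
  simp only [weight, add_le_add_iff_right, prod_thinned, stick]
  simp

end Stick

/-! ### Integrals of stick-breaking weights -/

section Law

variable (α : ℝ)

/-- The law of the stick-breaking variables. -/
noncomputable def stickLaw : Measure (ℕ → ℝ) := Measure.infinitePi fun _ : ℕ => betaMeasure 1 α

variable {α}

lemma isProbabilityMeasure_stickLaw (hα : 0 < α) : IsProbabilityMeasure (stickLaw α) := by
  have := isProbabilityMeasureBeta one_pos hα
  unfold stickLaw
  infer_instance

lemma ae_stickLaw_mem_Icc (hα : 0 < α) : ∀ᵐ v ∂stickLaw α, ∀ j, v j ∈ Set.Icc (0 : ℝ) 1 := by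
  have := isProbabilityMeasureBeta one_pos hα
  rw [ae_all_iff]
  intro j
  have h := (measurePreserving_eval_infinitePi (fun _ : ℕ => betaMeasure 1 α) j)
  have := h.quasiMeasurePreserving.ae (ae_betaMeasure_mem_Ioo 1 α)
  filter_upwards [this] with v hv
  exact Set.Ioo_subset_Icc_self hv

lemma integral_prod_stickLaw (hα : 0 < α) (s : Finset ℕ) (f : ℕ → ℝ → ℝ)
    (hf : ∀ i, Measurable (f i)) :
    ∫ v, ∏ i ∈ s, f i (v i) ∂stickLaw α = ∏ i ∈ s, ∫ x, f i x ∂betaMeasure 1 α := by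
  have := isProbabilityMeasureBeta one_pos hα
  have h := integral_restrict_infinitePi (μ := fun _ : ℕ => betaMeasure 1 α) (s := s)
    (f := fun x => ∏ i : s, f i (x i)) (by
      refine Measurable.aestronglyMeasurable ?_
      exact Finset.measurable_prod _ fun i _ => (hf i).comp (measurable_pi_apply i))
  rw [integral_fintype_prod_eq_prod] at h
  rw [← Finset.prod_coe_sort s (fun i => ∫ x, f i x ∂betaMeasure 1 α), ← h]
  refine integral_congr_ae (ae_of_all _ fun v => ?_)
  exact (Finset.prod_coe_sort s (fun i => f i (v i))).symm

/-- Injective reindexing preserves an iid product law, so moments need computing only for sticks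
starting at `0`. -/
lemma integral_shift_stickLaw (hα : 0 < α) (a : ℕ) {f : (ℕ → ℝ) → ℝ} (hf : Measurable f) :
    ∫ v, f (fun i => v (a + i)) ∂stickLaw α = ∫ v, f v ∂stickLaw α := by
  have := isProbabilityMeasureBeta one_pos hα
  have h := Measure.map_infinitePi_infinitePi_of_inj (P := fun _ : ℕ => betaMeasure 1 α)
    (add_right_injective a)
  conv_rhs => rw [stickLaw, ← h]
  rw [integral_map (measurable_pi_lambda _ fun i => measurable_pi_apply _).aemeasurable
    hf.aestronglyMeasurable]
  rfl

lemma integral_remainder_pow (hα : 0 < α) (a d r : ℕ) :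
    ∫ v, remainder a d v ^ r ∂stickLaw α = (α / (α + r)) ^ d := by
  rw [← integral_one_sub_pow_betaMeasure_one hα]
  have h := integral_shift_stickLaw hα a (f := fun v => remainder 0 d v ^ r) (by fun_prop)
  have h2 := integral_prod_stickLaw hα (Finset.range d) (fun _ x => (1 - x) ^ r)
    (fun _ => by fun_prop)
  simp only [remainder, zero_add, ← Finset.prod_pow, h2, Finset.prod_const, Finset.card_range] at h ⊢
  exact h

lemma integral_stick_pow (hα : 0 < α) (a k r : ℕ) :
    ∫ v, stick a k v ^ r ∂stickLaw α
      = (∫ x, x ^ r ∂betaMeasure 1 α) * (α / (α + r)) ^ k := by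
  rw [← integral_one_sub_pow_betaMeasure_one hα]
  have h := integral_shift_stickLaw hα a (f := fun v => stick 0 k v ^ r) (by fun_prop)
  have h2 := integral_prod_stickLaw hα (Finset.range (k + 1))
    (fun i x => if i = k then x ^ r else (1 - x) ^ r)
    (fun i => by split_ifs <;> fun_prop)
  have e : ∀ g₁ g₂ : ℕ → ℝ, ∏ i ∈ Finset.range (k + 1), (if i = k then g₁ i else g₂ i)
      = g₁ k * ∏ i ∈ Finset.range k, g₂ i := by
    intro g₁ g₂
    rw [Finset.prod_range_succ, if_pos rfl, mul_comm]
    congr 1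
    exact Finset.prod_congr rfl fun i hi => if_neg (Finset.mem_range.1 hi).ne
  have e2 : ∀ i, (∫ x, (if i = k then x ^ r else (1 - x) ^ r) ∂betaMeasure 1 α)
      = if i = k then ∫ x, x ^ r ∂betaMeasure 1 α else ∫ x, (1 - x) ^ r ∂betaMeasure 1 α := by
    intro i; split_ifs <;> rfl
  simp only [e2, e (fun _ => ∫ x, x ^ r ∂betaMeasure 1 α), Finset.prod_const,
    Finset.card_range] at h2
  rw [← h2]
  have h' : ∫ v, stick a k v ^ r ∂stickLaw α = ∫ v, stick 0 k v ^ r ∂stickLaw α := by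
    rw [← h]
    simp only [stick, remainder, zero_add]
  refine h'.trans (integral_congr_ae (ae_of_all _ fun v => ?_))
  simp only [e (fun i => v i ^ r) (fun i => (1 - v i) ^ r), stick, remainder, zero_add, mul_pow,
    Finset.prod_pow]

lemma integrable_of_bounded_on_unit (hα : 0 < α) {f : (ℕ → ℝ) → ℝ} (hf : Measurable f) (C : ℝ)
    (hC : ∀ v : ℕ → ℝ, (∀ j, v j ∈ Set.Icc (0 : ℝ) 1) → |f v| ≤ C) : Integrable f (stickLaw α) := by
  have := isProbabilityMeasure_stickLaw hα
  refine Integrable.of_bound hf.aestronglyMeasurable C ?_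
  filter_upwards [ae_stickLaw_mem_Icc hα] with v hv using hC v hv

lemma abs_le_one_of_mem_Icc {x : ℝ} (h : x ∈ Set.Icc (0 : ℝ) 1) : |x| ≤ 1 :=
  abs_le.2 ⟨by linarith [h.1], h.2⟩

lemma pow_mem_unit {x : ℝ} (h : x ∈ Set.Icc (0 : ℝ) 1) (n : ℕ) : x ^ n ∈ Set.Icc (0 : ℝ) 1 :=
  ⟨pow_nonneg h.1 n, pow_le_one₀ h.1 h.2⟩

lemma mul_mem_unit {x y : ℝ} (hx : x ∈ Set.Icc (0 : ℝ) 1) (hy : y ∈ Set.Icc (0 : ℝ) 1) :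
    x * y ∈ Set.Icc (0 : ℝ) 1 :=
  ⟨mul_nonneg hx.1 hy.1, mul_le_one₀ hx.2 hy.1 hy.2⟩

lemma one_sub_mem_unit {x : ℝ} (h : x ∈ Set.Icc (0 : ℝ) 1) : 1 - x ∈ Set.Icc (0 : ℝ) 1 :=
  ⟨by linarith [h.2], by linarith [h.1]⟩

lemma integrable_stick_pow (hα : 0 < α) (a k r : ℕ) :
    Integrable (fun v => stick a k v ^ r) (stickLaw α) :=
  integrable_of_bounded_on_unit hα (by fun_prop) 1 fun _ hv =>
    abs_le_one_of_mem_Icc (pow_mem_unit (stick_mem_Icc hv a k) r)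

lemma integrable_remainder_pow (hα : 0 < α) (a k r : ℕ) :
    Integrable (fun v => remainder a k v ^ r) (stickLaw α) :=
  integrable_of_bounded_on_unit hα (by fun_prop) 1 fun _ hv =>
    abs_le_one_of_mem_Icc (pow_mem_unit (remainder_mem_Icc hv a k) r)

lemma integrable_pow_betaMeasure (hα : 0 < α) (r : ℕ) :
    Integrable (fun x : ℝ => x ^ r) (betaMeasure 1 α) := by
  have := isProbabilityMeasureBeta one_pos hα
  refine Integrable.of_bound (by fun_prop) 1 ?_
  filter_upwards [ae_betaMeasure_mem_Ioo 1 α] with x hx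
  exact abs_le_one_of_mem_Icc (pow_mem_unit (Set.Ioo_subset_Icc_self hx) r)

/-- Size-biased picking: `∑ₖ 𝔼[wₖ ^ (l + 1)] = 𝔼[v ^ l]`. -/
lemma hasSum_integral_stick_pow_succ (hα : 0 < α) (a l : ℕ) :
    HasSum (fun k => ∫ v, stick a k v ^ (l + 1) ∂stickLaw α) (∫ x, x ^ l ∂betaMeasure 1 α) := by
  simp_rw [integral_stick_pow hα]
  have hl : 0 < α + (l + 1 : ℕ) := by positivity
  have hg := hasSum_geometric_of_lt_one (r := α / (α + (l + 1 : ℕ))) (by positivity)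
    ((div_lt_one hl).2 (by push_cast; linarith [(Nat.cast_nonneg l : (0 : ℝ) ≤ l)]))
  -- Summing the geometric series leaves a relation between consecutive beta moments, which is the
  -- recursion of `Gamma`.
  suffices h : ∫ x, x ^ l ∂betaMeasure 1 α
      = (∫ x, x ^ (l + 1) ∂betaMeasure 1 α) * (1 - α / (α + (l + 1 : ℕ)))⁻¹ by
    rw [h]
    exact hg.mul_left _
  rw [integral_pow_betaMeasure_one hα, integral_pow_betaMeasure_one hα]
  have h0 : 0 < α + l + 1 := by positivity
  have h1 : (0 : ℝ) < l + 1 := by positivity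
  have h2 := (Real.Gamma_pos_of_pos h0).ne'
  push_cast at hl ⊢
  rw [show α + ((l : ℝ) + 1) + 1 = (α + l + 1) + 1 by ring, Real.Gamma_add_one h0.ne',
    Real.Gamma_add_one h1.ne', show α + ((l : ℝ) + 1) = α + l + 1 by ring]
  have h3 : 1 - α / (α + l + 1) = (l + 1) / (α + l + 1) := by field_simp; ring
  rw [h3]
  field_simp

lemma one_sub_pow_expand (x : ℝ) (m : ℕ) :
    (1 - x) ^ m = ∑ l ∈ Finset.range (m + 1), (-1) ^ l * (m.choose l : ℝ) * x ^ l := by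
  rw [sub_eq_neg_add, add_pow]
  refine Finset.sum_congr rfl fun l _ => ?_
  rw [neg_pow, one_pow]; ring

/-- This is the chance that a draw hits an atom missed by `m` earlier draws. Size-biased picking,
applied to each power of the weight, turns the sum into `𝔼[(1 - v)^m]`. -/
lemma hasSum_integral_stick_mul_one_sub_pow (hα : 0 < α) (a m : ℕ) :
    HasSum (fun k => ∫ v, stick a k v * (1 - stick a k v) ^ m ∂stickLaw α) (α / (α + m)) := by
  rw [← integral_one_sub_pow_betaMeasure_one hα]
  have e1 : ∀ k, ∫ v, stick a k v * (1 - stick a k v) ^ m ∂stickLaw α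
      = ∑ l ∈ Finset.range (m + 1), (-1) ^ l * (m.choose l : ℝ) *
        ∫ v, stick a k v ^ (l + 1) ∂stickLaw α := by
    intro k
    simp_rw [one_sub_pow_expand, Finset.mul_sum]
    have : ∀ (v : ℕ → ℝ) (l : ℕ), stick a k v * ((-1) ^ l * (m.choose l : ℝ) * stick a k v ^ l)
        = (-1) ^ l * (m.choose l : ℝ) * stick a k v ^ (l + 1) := fun v l => by ring
    simp_rw [this]
    rw [integral_finsetSum _ fun l _ => (integrable_stick_pow hα a k (l + 1)).const_mul _]
    simp_rw [integral_const_mul]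
  have e2 : ∫ x, (1 - x) ^ m ∂betaMeasure 1 α
      = ∑ l ∈ Finset.range (m + 1), (-1) ^ l * (m.choose l : ℝ) *
        ∫ x, x ^ l ∂betaMeasure 1 α := by
    simp_rw [one_sub_pow_expand]
    rw [integral_finsetSum _ fun l _ => (integrable_pow_betaMeasure hα l).const_mul _]
    simp_rw [integral_const_mul]
  simp_rw [e1]
  rw [e2]
  exact hasSum_sum fun l _ => (hasSum_integral_stick_pow_succ hα a l).mul_left _

/-- The expected number of distinct atoms hit by `m` draws. -/
lemma hasSum_integral_one_sub_one_sub_pow (hα : 0 < α) (a m : ℕ) :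
    HasSum (fun k => ∫ v, (1 - (1 - stick a k v) ^ m) ∂stickLaw α)
      (∑ i ∈ Finset.Icc 1 m, α / (α + (i : ℝ) - 1)) := by
  induction m with
  | zero => simp
  | succ m ih =>
    rw [Finset.sum_Icc_succ_top (by omega)]
    -- `1 - (1 - s)^(m+1) = (1 - (1 - s)^m) + s (1 - s)^m`: one more draw adds the chance of a new
    -- atom.
    have h := ih.add (hasSum_integral_stick_mul_one_sub_pow hα a m)
    convert h using 2 with k
    · rw [← integral_add]
      · refine integral_congr_ae (ae_of_all _ fun v => ?_)
        ring
      · exact integrable_of_bounded_on_unit hα (by fun_prop) 1 fun v hv => abs_le_one_of_mem_Icc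
          (one_sub_mem_unit (pow_mem_unit (one_sub_mem_unit (stick_mem_Icc hv a k)) m))
      · exact integrable_of_bounded_on_unit hα (by fun_prop) 1 fun v hv => abs_le_one_of_mem_Icc
          (mul_mem_unit (stick_mem_Icc hv a k)
            (pow_mem_unit (one_sub_mem_unit (stick_mem_Icc hv a k)) m))
    · push_cast; ring_nf

/-- The total is at most `1` because partial sums telescope, and its mean is `1` by size-biased
picking with `l = 0`; so it equals `1` a.s. -/
lemma ae_tsum_stick_eq_one (hα : 0 < α) (a : ℕ) :
    ∀ᵐ v ∂stickLaw α, ∑' k, ENNReal.ofReal (stick a k v) = 1 := by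
  have := isProbabilityMeasure_stickLaw hα
  have hle : ∀ᵐ v ∂stickLaw α, ∑' k, ENNReal.ofReal (stick a k v) ≤ 1 := by
    filter_upwards [ae_stickLaw_mem_Icc hα] with v hv
    refine ENNReal.tsum_le_of_sum_range_le fun n => ?_
    rw [← ENNReal.ofReal_sum_of_nonneg fun k _ => (stick_mem_Icc hv a k).1, sum_stick,
      ENNReal.ofReal_le_one]
    linarith [(remainder_mem_Icc hv a n).1]
  have hint : ∫⁻ v, ∑' k, ENNReal.ofReal (stick a k v) ∂stickLaw α = 1 := by
    rw [lintegral_tsum fun k => by fun_prop]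
    have h := hasSum_integral_stick_pow_succ hα a 0
    have hp := isProbabilityMeasureBeta one_pos hα
    simp only [zero_add, pow_one, pow_zero, integral_const, probReal_univ, smul_eq_mul,
      mul_one] at h
    have hnn : ∀ k, 0 ≤ᵐ[stickLaw α] stick a k := fun k => by
      filter_upwards [ae_stickLaw_mem_Icc hα] with v hv using (stick_mem_Icc hv a k).1
    have e : ∀ k, ∫⁻ v, ENNReal.ofReal (stick a k v) ∂stickLaw α
        = ENNReal.ofReal (∫ v, stick a k v ∂stickLaw α) := fun k =>
      (ofReal_integral_eq_lintegral_ofReal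
        (by simpa using integrable_stick_pow hα a k 1) (hnn k)).symm
    simp_rw [e]
    rw [← ENNReal.ofReal_tsum_of_nonneg (fun k => integral_nonneg_of_ae (hnn k)) h.summable,
      h.tsum_eq, ENNReal.ofReal_one]
  refine ae_eq_of_ae_le_of_lintegral_le hle (by simp [hint]) (by fun_prop) ?_
  simp [hint]

/-- The two functions read disjoint finite blocks of independent coordinates. -/
lemma indepFun_remainder_stick (hα : 0 < α) (a d k : ℕ) :
    IndepFun (remainder a d) (stick (a + d) k) (stickLaw α) := by
  have := isProbabilityMeasureBeta one_pos hα
  have hi : iIndepFun (fun (i : ℕ) (v : ℕ → ℝ) => v i) (stickLaw α) :=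
    iIndepFun_infinitePi (X := fun _ x => x) (P := fun _ : ℕ => betaMeasure 1 α)
      fun _ => measurable_id
  have h := hi.indepFun_finset (Finset.Ico a (a + d)) (Finset.Ico (a + d) (a + d + k + 1))
    (Finset.disjoint_left.2 fun x hx hy => by simp at hx hy; omega) fun _ => by fun_prop
  -- Extension by `0` lets functions of whole sequences act on a finite block; the value `0` is
  -- never read.
  let ext : (s : Finset ℕ) → (s → ℝ) → ℕ → ℝ := fun s x i => if hi : i ∈ s then x ⟨i, hi⟩ else 0
  have hext : ∀ s, Measurable (ext s) := fun s => by
    refine measurable_pi_lambda _ fun i => ?_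
    by_cases hi : i ∈ s
    · simp only [ext, hi, dite_true]; fun_prop
    · simp only [ext, hi, dite_false]; fun_prop
  convert h.comp ((measurable_remainder a d).comp (hext _))
    ((measurable_stick (a + d) k).comp (hext _)) using 1
  · funext v
    refine Finset.prod_congr rfl fun i hi => ?_
    have : a ≤ a + i ∧ a + i < a + d := by simp at hi; omega
    simp [ext, this.2]
  · funext v
    have h1 : ∀ i ≤ k, ext (Finset.Ico (a + d) (a + d + k + 1)) (fun i => v i) (a + d + i)
        = v (a + d + i) := fun i hi => by
      have : a + d + i < a + d + k + 1 := by omega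
      simp [ext, this]
    simp only [Function.comp, stick, remainder]
    rw [h1 k le_rfl]
    congr 1
    exact Finset.prod_congr rfl fun i hi => by rw [h1 i (by simp at hi; omega)]

end Law

/-! ### Sampling from discrete random measures -/

section Mixture

open scoped ENNReal

lemma tsum_pi_fin_prod (N : ℕ) (f : Fin N → ℕ → ℝ≥0∞) :
    ∑' j : Fin N → ℕ, ∏ i, f i (j i) = ∏ i, ∑' k, f i k := by
  induction N with
  | zero => simp
  | succ N ih =>
    rw [Fin.prod_univ_succ, ← ih, ← (Fin.consEquiv fun _ : Fin (N + 1) => ℕ).tsum_eq,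
      ENNReal.tsum_prod', ← ENNReal.tsum_mul_right]
    refine tsum_congr fun k => ?_
    rw [← ENNReal.tsum_mul_left]
    refine tsum_congr fun j => ?_
    simp [Fin.prod_univ_succ, Fin.consEquiv]

variable {ι : Type*} [Fintype ι]

lemma tsum_pi_prod (f : ι → ℕ → ℝ≥0∞) :
    ∑' j : ι → ℕ, ∏ i, f i (j i) = ∏ i, ∑' k, f i k := by
  let e := Fintype.equivFin ι
  rw [← e.symm.prod_comp, ← tsum_pi_fin_prod, ← (e.arrowCongr (Equiv.refl ℕ)).symm.tsum_eq]
  refine tsum_congr fun j => ?_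
  rw [← e.symm.prod_comp]
  simp [Equiv.arrowCongr]

/-- The expected number of distinct values of independent draws `j i ∼ w i`. -/
lemma tsum_prod_mul_ncard_range (w : ι → ℕ → ℝ≥0∞) (hw : ∀ i, ∑' k, w i k = 1) :
    ∑' j : ι → ℕ, (∏ i, w i (j i)) * ((Set.range j).ncard : ℝ≥0∞)
      = ∑' k, (1 - ∏ i, (1 - w i k)) := by
  classical
  have hcard : ∀ j : ι → ℕ, ((Set.range j).ncard : ℝ≥0∞)
      = ∑' k, if ∃ i, j i = k then 1 else 0 := by
    intro j
    rw [← Set.image_univ, ← Finset.coe_univ, ← Finset.coe_image, Set.ncard_coe_finset,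
      tsum_eq_sum (s := Finset.univ.image j) (by simp), Finset.card_eq_sum_ones, Nat.cast_sum]
    refine Finset.sum_congr rfl fun k hk => ?_
    rw [if_pos (by simpa using hk), Nat.cast_one]
  simp_rw [hcard, ← ENNReal.tsum_mul_left]
  rw [ENNReal.tsum_comm]
  refine tsum_congr fun k => ?_
  -- Missing `k` amounts to setting every weight at `k` to zero, after which the sum over index
  -- vectors factorises.
  have hmiss : ∑' j : ι → ℕ, (∏ i, w i (j i)) * (if ∃ i, j i = k then 0 else 1)
      = ∏ i, (1 - w i k) := by
    have : ∀ j : ι → ℕ, (∏ i, w i (j i)) * (if ∃ i, j i = k then (0 : ℝ≥0∞) else 1)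
        = ∏ i, (if j i = k then 0 else w i (j i)) := by
      intro j
      by_cases h : ∃ i, j i = k
      · obtain ⟨i, hi⟩ := h
        rw [if_pos ⟨i, hi⟩, mul_zero]
        symm
        refine Finset.prod_eq_zero (Finset.mem_univ i) ?_
        exact if_pos hi
      · rw [if_neg h, mul_one]
        push Not at h
        exact Finset.prod_congr rfl fun i _ => (if_neg (h i)).symm
    simp_rw [this]
    rw [tsum_pi_prod fun i l => if l = k then 0 else w i l]
    refine Finset.prod_congr rfl fun i _ => ?_
    have hk : w i k ≠ ∞ := ne_top_of_le_ne_top (by simp) ((ENNReal.le_tsum k).trans (hw i).le)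
    refine ENNReal.eq_sub_of_add_eq hk ?_
    rw [← hw i, ← tsum_ite_eq k (fun _ => w i k), ← ENNReal.tsum_add]
    refine tsum_congr fun l => ?_
    split_ifs with h <;> simp [h]
  have htot : ∑' j : ι → ℕ, (∏ i, w i (j i)) = 1 := by
    rw [tsum_pi_prod]; simp [hw]
  refine ENNReal.eq_sub_of_add_eq (ENNReal.prod_ne_top fun i _ => by simp) ?_
  rw [← hmiss, ← ENNReal.tsum_add]
  refine Eq.trans ?_ htot
  refine tsum_congr fun j => ?_
  split_ifs <;> simp

/-- The count depends only on the pattern of equalities among the coordinates, which lies in a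
finite discrete space; each equality is an event because the diagonal is measurable. -/
lemma measurable_ncard_range {Θ : Type*} [MeasurableSpace Θ] [MeasurableEq Θ] :
    Measurable fun y : ι → Θ => (Set.range y).ncard := by
  have h : (fun y : ι → Θ => (Set.range y).ncard)
      = (fun R : ι → ι → Prop => (Set.range R).ncard) ∘ fun y i j => y i = y j := by
    funext y
    have hR : ∀ i j, y i = y j ↔ (fun k => y i = y k) = fun k => y j = y k := fun i j =>
      ⟨fun h => by rw [h], fun h => ((congrFun h j).mpr rfl)⟩
    refine Set.ncard_congr (fun θ _ => fun k => θ = y k) ?_ ?_ ?_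
    · rintro _ ⟨i, rfl⟩; exact ⟨i, rfl⟩
    · rintro _ _ ⟨i, rfl⟩ ⟨j, rfl⟩ h; exact (hR i j).2 h
    · rintro _ ⟨i, rfl⟩; exact ⟨y i, ⟨i, rfl⟩, rfl⟩
  rw [h]
  refine Measurable.of_discrete.comp ?_
  exact measurable_pi_lambda _ fun i => measurable_pi_lambda _ fun j =>
    (measurable_pi_apply i).eq (measurable_pi_apply j)

/-- A sample from random discrete measures `∑ₖ w i k δ_{θ k}` may be drawn by first choosing
indices `j i` with weights `w i`. -/
lemma lintegral_of_discrete_mixture {Ω X Θ : Type*} [MeasurableSpace Ω] [MeasurableSpace X]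
    [MeasurableSpace Θ] {P : Measure Ω} [IsFiniteMeasure P] {μ : Measure X}
    {w : ι → ℕ → X → ℝ≥0∞} (hw : ∀ i k, Measurable (w i k))
    {θ : ℕ → X → Θ} (hθ : ∀ k, Measurable (θ k))
    {Y : ι → Ω → Θ} (hY : ∀ i, Measurable (Y i))
    (h : ∀ A : ι → Set Θ, (∀ i, MeasurableSet (A i)) → P {ω | ∀ i, Y i ω ∈ A i}
      = ∫⁻ x, ∏ i, ∑' k, w i k x * (A i).indicator 1 (θ k x) ∂μ)
    {f : (ι → Θ) → ℝ≥0∞} (hf : Measurable f) :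
    ∫⁻ ω, f (fun i => Y i ω) ∂P
      = ∫⁻ x, ∑' j : ι → ℕ, (∏ i, w i (j i) x) * f (fun i => θ (j i) x) ∂μ := by
  have hwj : ∀ j : ι → ℕ, Measurable fun x => ∏ i, w i (j i) x := fun j =>
    Finset.measurable_prod _ fun i _ => hw i (j i)
  have hθj : ∀ j : ι → ℕ, Measurable fun x i => θ (j i) x := fun j =>
    measurable_pi_lambda _ fun i => hθ (j i)
  -- `ν` is the law obtained by drawing indices first; agreement with the sample on rectangles
  -- identifies the two laws.
  set ν : Measure (ι → Θ) := Measure.sum fun j : ι → ℕ =>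
    (μ.withDensity fun x => ∏ i, w i (j i) x).map fun x i => θ (j i) x with hν
  have hνf : ∀ g : (ι → Θ) → ℝ≥0∞, Measurable g → ∫⁻ y, g y ∂ν
      = ∫⁻ x, ∑' j : ι → ℕ, (∏ i, w i (j i) x) * g (fun i => θ (j i) x) ∂μ := by
    intro g hg
    rw [hν, lintegral_sum_measure, lintegral_tsum fun j =>
      show AEMeasurable (fun x => (∏ i, w i (j i) x) * g fun i => θ (j i) x) μ from
        ((hwj j).mul (hg.comp (hθj j))).aemeasurable]
    refine tsum_congr fun j => ?_
    rw [lintegral_map hg (hθj j)]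
    exact lintegral_withDensity_eq_lintegral_mul _ (hwj j) (hg.comp (hθj j))
  have hYm : Measurable fun ω i => Y i ω := measurable_pi_lambda _ hY
  have hrect : ∀ A : ι → Set Θ, (∀ i, MeasurableSet (A i)) →
      (P.map fun ω i => Y i ω) (Set.univ.pi A) = ν (Set.univ.pi A) := by
    intro A hA
    have hm : MeasurableSet (Set.univ.pi A) := MeasurableSet.univ_pi hA
    rw [Measure.map_apply hYm hm, ← lintegral_indicator_one hm, hνf _ (measurable_one.indicator hm)]
    have : (fun ω i => Y i ω) ⁻¹' Set.univ.pi A = {ω | ∀ i, Y i ω ∈ A i} := by ext; simp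
    rw [this, h A hA]
    refine lintegral_congr fun x => ?_
    rw [← tsum_pi_prod fun i k => w i k x * (A i).indicator 1 (θ k x)]
    refine tsum_congr fun j => ?_
    rw [Finset.prod_mul_distrib]
    congr 1
    classical
    simp only [Set.indicator_apply, Pi.one_apply, Finset.prod_ite_zero, Finset.prod_const_one,
      Set.mem_pi, Set.mem_univ, Finset.mem_univ, true_imp_iff]
  have hext : (P.map fun ω i => Y i ω) = ν := by
    refine ext_of_generate_finite _ generateFrom_pi.symm isPiSystem_pi ?_ ?_
    · rintro _ ⟨A, hA, rfl⟩
      exact hrect A fun i => hA i (Set.mem_univ i)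
    · simpa using hrect (fun _ => Set.univ) fun _ => MeasurableSet.univ
  rw [← lintegral_map hf hYm, hext, hνf f hf]

lemma ae_injective_infinitePi {Θ : Type*} [MeasurableSpace Θ] [MeasurableEq Θ] {P₀ : Measure Θ}
    [IsProbabilityMeasure P₀] (hP₀ : ∀ x : Θ, P₀ {x} = 0) :
    ∀ᵐ θ ∂Measure.infinitePi fun _ : ℕ => P₀, Function.Injective θ := by
  have h : ∀ i j : ℕ, ∀ᵐ θ ∂Measure.infinitePi fun _ : ℕ => P₀, i ≠ j → θ i ≠ θ j := by
    intro i j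
    by_cases hij : i = j
    · exact ae_of_all _ fun _ h => absurd hij h
    -- By Fubini: each slice of the diagonal is a singleton, hence null.
    have hd : (P₀.prod P₀) (Set.diagonal Θ) = 0 := by
      rw [Measure.measure_prod_null measurableSet_diagonal]
      refine ae_of_all _ fun x => ?_
      have : Prod.mk x ⁻¹' Set.diagonal Θ = {x} := by ext y; simp [eq_comm]
      exact (congrArg P₀ this).trans (hP₀ x)
    rw [← Measure.infinitePi_map_eval_prod (P := fun _ : ℕ => P₀) hij,
      Measure.map_apply (by fun_prop) measurableSet_diagonal] at hd
    filter_upwards [measure_eq_zero_iff_ae_notMem.1 hd] with θ hθ _ e using hθ e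
  have h' := ae_all_iff.2 fun i => ae_all_iff.2 (h i)
  filter_upwards [h'] with θ hθ i j e
  by_contra hij
  exact hθ i j hij e

end Mixture

/-! ### Evaluating the private and shared contributions -/

section Moments

variable {α : ℝ}

lemma sum_Icc_one_eq_sum_range (n : ℕ) (f : ℕ → ℝ) :
    ∑ r ∈ Finset.Icc 1 n, f r = ∑ r ∈ Finset.range n, f (r + 1) := by
  induction n with
  | zero => simp
  | succ n ih => rw [Finset.sum_Icc_succ_top (by omega), ih, Finset.sum_range_succ]

lemma one_sub_one_sub_pow_expand (x : ℝ) (n : ℕ) :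
    1 - (1 - x) ^ n = ∑ r ∈ Finset.Icc 1 n, (-1) ^ (r - 1) * (n.choose r : ℝ) * x ^ r := by
  rw [sum_Icc_one_eq_sum_range, one_sub_pow_expand, Finset.sum_range_succ', pow_zero, pow_zero,
    Nat.choose_zero_right, Nat.cast_one, one_mul, one_mul, sub_add_cancel_right, ← Finset.sum_neg_distrib]
  refine Finset.sum_congr rfl fun r _ => ?_
  rw [Nat.add_sub_cancel, pow_succ (-1 : ℝ)]
  ring

/-- After binomial expansion the sum over `k` is geometric; dividing by `1 - α / (α + r) = r / (α +
r)` lowers both `Gamma` arguments of the beta moment by one. -/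
lemma sum_integral_one_sub_one_sub_stick_pow (hα : 0 < α) (a d n : ℕ) :
    ∑ k ∈ Finset.range d, ∫ v, (1 - (1 - stick a k v) ^ n) ∂stickLaw α
      = ∑ r ∈ Finset.Icc 1 n, (-1 : ℝ) ^ (r - 1) * (n.choose r : ℝ) *
        (Real.Gamma (α + 1) * Real.Gamma (r : ℝ) / Real.Gamma (α + (r : ℝ))) *
        (1 - (α / (α + (r : ℝ))) ^ d) := by
  have e : ∀ k, ∫ v, (1 - (1 - stick a k v) ^ n) ∂stickLaw α
      = ∑ r ∈ Finset.Icc 1 n, (-1) ^ (r - 1) * (n.choose r : ℝ) *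
        ((∫ x, x ^ r ∂betaMeasure 1 α) * (α / (α + r)) ^ k) := by
    intro k
    simp_rw [one_sub_one_sub_pow_expand]
    rw [integral_finsetSum _ fun r _ => (integrable_stick_pow hα a k r).const_mul _]
    simp_rw [integral_const_mul, integral_stick_pow hα]
  simp_rw [e]
  rw [Finset.sum_comm]
  refine Finset.sum_congr rfl fun r hr => ?_
  have hr0 : (0 : ℝ) < r := by exact_mod_cast (Finset.mem_Icc.1 hr).1
  have hαr : 0 < α + r := by positivity
  have hq : α / (α + r) ≠ 1 := by
    rw [Ne, div_eq_one_iff_eq hαr.ne']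
    linarith
  have h2 := (Real.Gamma_pos_of_pos hαr).ne'
  have h3 : α / (α + r) - 1 = - (r / (α + r)) := by field_simp; ring
  rw [← Finset.mul_sum, ← Finset.mul_sum, geom_sum_eq hq, integral_pow_betaMeasure_one hα,
    Real.Gamma_add_one hr0.ne', Real.Gamma_add_one hαr.ne', h3]
  generalize (α / (α + r)) ^ d = q
  field_simp
  ring

/-- Expand `((1 - W) + W (1 - s))^n₁`, and write the leading `1` as `((1 - W) + W)^n₁` to match it
term by term. -/
lemma one_sub_mul_pow_expand (W s : ℝ) (n₁ n₂ : ℕ) :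
    1 - (1 - W * s) ^ n₁ * (1 - s) ^ n₂
      = ∑ r ∈ Finset.range (n₁ + 1), (n₁.choose r : ℝ) *
        (((1 - W) ^ r * W ^ (n₁ - r)) * (1 - (1 - s) ^ (n₂ + n₁ - r))) := by
  have h1 : ∑ r ∈ Finset.range (n₁ + 1), (1 - W) ^ r * W ^ (n₁ - r) * n₁.choose r = 1 := by
    rw [← add_pow]; simp
  have h2 : (1 - W * s) ^ n₁ = ∑ r ∈ Finset.range (n₁ + 1),
      (1 - W) ^ r * (W * (1 - s)) ^ (n₁ - r) * n₁.choose r := by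
    rw [← add_pow]; ring
  refine (congrArg₂ (· - ·) h1.symm (by rw [h2, Finset.sum_mul])).trans ?_
  rw [← Finset.sum_sub_distrib]
  refine Finset.sum_congr rfl fun r hr => ?_
  have : n₂ + n₁ - r = (n₁ - r) + n₂ := by have := Finset.mem_range.1 hr; omega
  rw [this, pow_add, mul_pow]
  ring

lemma integral_one_sub_remainder_pow_mul (hα : 0 < α) (a d r m : ℕ) :
    ∫ v, (1 - remainder a d v) ^ r * remainder a d v ^ m ∂stickLaw α
      = ∑ l ∈ Finset.range (r + 1), (-1 : ℝ) ^ l * (r.choose l : ℝ) *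
        (α / (α + ((l + m : ℕ) : ℝ))) ^ d := by
  simp_rw [one_sub_pow_expand, Finset.sum_mul, mul_assoc, ← pow_add]
  simp_rw [← mul_assoc]
  rw [integral_finsetSum _ fun l _ => (integrable_remainder_pow hα a d (l + m)).const_mul _]
  simp_rw [integral_const_mul, integral_remainder_pow hα]

/-- For each `r`, independence separates the factor in `W` from the factor in `s`, and only the
latter is summed over `k`. -/
lemma hasSum_integral_one_sub_two_groups (hα : 0 < α) (a d n₁ n₂ : ℕ) :
    HasSum (fun k => ∫ v, (1 - (1 - remainder a d v * stick (a + d) k v) ^ n₁ *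
        (1 - stick (a + d) k v) ^ n₂) ∂stickLaw α)
      (∑ r ∈ Finset.range (n₁ + 1), (n₁.choose r : ℝ) *
        (∑ i ∈ Finset.Icc 1 (n₂ + n₁ - r), α / (α + (i : ℝ) - 1)) *
        ∑ l ∈ Finset.range (r + 1), (-1 : ℝ) ^ l * (r.choose l : ℝ) *
          (α / (α + (l : ℝ) + (n₁ : ℝ) - (r : ℝ))) ^ d) := by
  have e : ∀ k, ∫ v, (1 - (1 - remainder a d v * stick (a + d) k v) ^ n₁ *
        (1 - stick (a + d) k v) ^ n₂) ∂stickLaw α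
      = ∑ r ∈ Finset.range (n₁ + 1), (n₁.choose r : ℝ) *
        ((∫ v, (1 - remainder a d v) ^ r * remainder a d v ^ (n₁ - r) ∂stickLaw α) *
          ∫ v, (1 - (1 - stick (a + d) k v) ^ (n₂ + n₁ - r)) ∂stickLaw α) := by
    intro k
    simp_rw [one_sub_mul_pow_expand]
    rw [integral_finsetSum]
    · refine Finset.sum_congr rfl fun r _ => ?_
      rw [integral_const_mul]
      congr 1
      have hind := (indepFun_remainder_stick hα a d k).comp
        (φ := fun x => (1 - x) ^ r * x ^ (n₁ - r))
        (ψ := fun x => 1 - (1 - x) ^ (n₂ + n₁ - r)) (by fun_prop) (by fun_prop)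
      exact hind.integral_fun_mul_eq_mul_integral
        (by unfold Function.comp; fun_prop) (by unfold Function.comp; fun_prop)
    · intro r _
      refine (integrable_of_bounded_on_unit hα (by fun_prop) 1 fun v hv => ?_).const_mul _
      have hW := remainder_mem_Icc hv a d
      have hs := stick_mem_Icc hv (a + d) k
      exact abs_le_one_of_mem_Icc (mul_mem_unit
        (mul_mem_unit (pow_mem_unit (one_sub_mem_unit hW) _) (pow_mem_unit hW _))
        (one_sub_mem_unit (pow_mem_unit (one_sub_mem_unit hs) _)))
  simp_rw [e]
  refine hasSum_sum fun r hr => ?_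
  have hsum := (hasSum_integral_one_sub_one_sub_pow hα (a + d) (n₂ + n₁ - r)).mul_left
    ((n₁.choose r : ℝ) *
      ∫ v, (1 - remainder a d v) ^ r * remainder a d v ^ (n₁ - r) ∂stickLaw α)
  have hr' : r ≤ n₁ := by have := Finset.mem_range.1 hr; omega
  have hE : ∫ v, (1 - remainder a d v) ^ r * remainder a d v ^ (n₁ - r) ∂stickLaw α
      = ∑ l ∈ Finset.range (r + 1), (-1 : ℝ) ^ l * (r.choose l : ℝ) *
          (α / (α + (l : ℝ) + (n₁ : ℝ) - (r : ℝ))) ^ d := by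
    rw [integral_one_sub_remainder_pow_mul hα]
    refine Finset.sum_congr rfl fun l _ => ?_
    rw [Nat.cast_add, Nat.cast_sub hr', ← add_sub_assoc, ← add_sub_assoc, ← add_assoc]
  simp_rw [← mul_assoc]
  rw [← hE, mul_right_comm]
  exact hsum

/-- The probability, given the weights, that atom `k` appears among the observations, summed over
all atoms and averaged over the weights. -/
lemma hasSum_integral_one_sub_weight (hα : 0 < α) (a d n₁ n₂ : ℕ) :
    HasSum (fun k => ∫ v, (1 - (1 - weight (fun j => decide (a + 1 ≤ j + 1)) v k) ^ n₁ *
        (1 - weight (fun j => decide (a + d + 1 ≤ j + 1)) v k) ^ n₂) ∂stickLaw α)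
      ((∑ r ∈ Finset.Icc 1 n₁, (-1 : ℝ) ^ (r - 1) * (n₁.choose r : ℝ) *
        (Real.Gamma (α + 1) * Real.Gamma (r : ℝ) / Real.Gamma (α + (r : ℝ))) *
        (1 - (α / (α + (r : ℝ))) ^ d)) +
      ∑ r ∈ Finset.range (n₁ + 1), (n₁.choose r : ℝ) *
        (∑ i ∈ Finset.Icc 1 (n₂ + n₁ - r), α / (α + (i : ℝ) - 1)) *
        ∑ l ∈ Finset.range (r + 1), (-1 : ℝ) ^ l * (r.choose l : ℝ) *
          (α / (α + (l : ℝ) + (n₁ : ℝ) - (r : ℝ))) ^ d) := by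
  rw [← sum_integral_one_sub_one_sub_stick_pow hα a d n₁]
  have h := (hasSum_nat_add_iff (f := fun k => ∫ v,
    (1 - (1 - weight (fun j => decide (a + 1 ≤ j + 1)) v k) ^ n₁ *
        (1 - weight (fun j => decide (a + d + 1 ≤ j + 1)) v k) ^ n₂) ∂stickLaw α) (a + d)).1
    (by
      have h2 := hasSum_integral_one_sub_two_groups hα a d n₁ n₂
      refine h2.congr_fun fun k => ?_
      simp_rw [add_comm k (a + d), weight_add, add_assoc a d k, weight_add, stick_add])
  suffices hs : ∑ k ∈ Finset.range d, ∫ v, (1 - (1 - stick a k v) ^ n₁) ∂stickLaw α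
      = ∑ k ∈ Finset.range (a + d),
        ∫ v, (1 - (1 - weight (fun j => decide (a + 1 ≤ j + 1)) v k) ^ n₁ *
          (1 - weight (fun j => decide (a + d + 1 ≤ j + 1)) v k) ^ n₂) ∂stickLaw α by
    rw [hs, add_comm (Finset.sum (Finset.range (a + d)) _)]
    exact h
  -- The first `a` indices have weight zero in both groups; the next `d` only in the second.
  rw [Finset.sum_range_add, Finset.sum_eq_zero (s := Finset.range a), zero_add]
  · refine Finset.sum_congr rfl fun k hk => ?_
    have hk' : a + k < a + d := by have := Finset.mem_range.1 hk; omega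
    simp_rw [weight_add, weight_of_lt hk']
    simp
  · intro k hk
    have hk1 : k < a := Finset.mem_range.1 hk
    have hk2 : k < a + d := by omega
    simp_rw [weight_of_lt hk1, weight_of_lt hk2]
    simp

end Moments

/-! ### Reducing the expected count to weights -/

section NumDistinct

open scoped ENNReal

variable {α : ℝ}

lemma weight_mem_Icc {v : ℕ → ℝ} (hv : ∀ j, v j ∈ Set.Icc (0 : ℝ) 1) (u k : ℕ) :
    weight (fun j => decide (u + 1 ≤ j + 1)) v k ∈ Set.Icc (0 : ℝ) 1 := by
  rcases lt_or_ge k u with h | h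
  · rw [weight_of_lt h]; simp
  · obtain ⟨k, rfl⟩ := Nat.exists_eq_add_of_le h
    rw [weight_add]
    exact stick_mem_Icc hv u k

@[fun_prop]
lemma measurable_weight (ℓ : ℕ → Bool) (k : ℕ) : Measurable fun v => weight ℓ v k := by
  unfold weight; fun_prop

lemma ae_tsum_weight_eq_one (hα : 0 < α) (u : ℕ) :
    ∀ᵐ v ∂stickLaw α, ∑' k, ENNReal.ofReal (weight (fun j => decide (u + 1 ≤ j + 1)) v k) = 1 := by
  filter_upwards [ae_tsum_stick_eq_one hα u] with v hv
  rw [← ENNReal.summable.sum_add_tsum_nat_add' (k := u), Finset.sum_eq_zero, zero_add, ← hv]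
  · simp_rw [add_comm _ u, weight_add]
  · intro k hk
    rw [weight_of_lt (Finset.mem_range.1 hk), ENNReal.ofReal_zero]

/-- Viewing all samples as one finite family makes the single-family mixture lemmas applicable. -/
lemma numDistinct_eq_ncard_range {Θ : Type*} {G : ℕ} {n : Fin G → ℕ}
    (y : (g : Fin G) → Fin (n g) → Θ) :
    numDistinct y = (Set.range fun i : Σ g, Fin (n g) => y i.1 i.2).ncard := by
  rw [numDistinct, Set.range_sigma_eq_iUnion_range]

lemma measurable_numDistinct {Ω Θ : Type*} [MeasurableSpace Ω] [MeasurableSpace Θ] [MeasurableEq Θ]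
    {G : ℕ} {n : Fin G → ℕ} {y : (g : Fin G) → Fin (n g) → Ω → Θ}
    (hy : ∀ g i, Measurable (y g i)) : Measurable fun ω => numDistinct fun g i => y g i ω := by
  simp_rw [numDistinct_eq_ncard_range]
  exact measurable_ncard_range.comp (measurable_pi_lambda _ fun i : Σ g, Fin (n g) => hy i.1 i.2)

lemma construct_apply {Θ : Type*} [MeasurableSpace Θ] {G : ℕ} (ℓ : Fin G → ℕ → Bool)
    (x : (ℕ → ℝ) × (ℕ → Θ)) (g : Fin G) {A : Set Θ} (hA : MeasurableSet A) :
    construct ℓ x g A = ∑' k, ENNReal.ofReal (weight (ℓ g) x.1 k) * A.indicator 1 (x.2 k) := by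
  simp only [construct, Measure.sum_apply _ hA, Measure.smul_apply, smul_eq_mul,
    Measure.dirac_apply' _ hA]

/-- The probabilities of rectangles under the joint law of the observations. -/
lemma IsConditionallyIIDSample.measure_forall_mem {Ω Θ : Type*} [MeasurableSpace Ω]
    [MeasurableSpace Θ] {P : Measure Ω} {P₀ : Measure Θ} {G : ℕ} {ℓ : Fin G → ℕ → Bool}
    {n : Fin G → ℕ} {p : Ω → Fin G → Measure Θ} (hp : HasLaw p (law α P₀ ℓ) P)
    {y : (g : Fin G) → Fin (n g) → Ω → Θ} (hy : IsConditionallyIIDSample P p n y)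
    (A : (Σ g, Fin (n g)) → Set Θ) (hA : ∀ i, MeasurableSet (A i)) :
    P {ω | ∀ i : Σ g, Fin (n g), y i.1 i.2 ω ∈ A i}
      = ∫⁻ x, ∏ i, ∑' k, ENNReal.ofReal (weight (ℓ i.1) x.1 k) * (A i).indicator 1 (x.2 k)
        ∂inputLaw α P₀ := by
  -- With `C` the whole space, only the joint law of the observations is used.
  have h := hy.cond_law (fun g i => A ⟨g, i⟩) (fun g i => hA ⟨g, i⟩) Set.univ MeasurableSet.univ
  rw [Set.preimage_univ, Set.univ_inter, Measure.restrict_univ] at h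
  have hset : {ω | ∀ i : Σ g, Fin (n g), y i.1 i.2 ω ∈ A i}
      = {ω | ∀ g i, y g i ω ∈ A ⟨g, i⟩} := by
    ext ω
    exact Sigma.forall
  have hF : Measurable fun q : Fin G → Measure Θ => ∏ g, ∏ i, q g (A ⟨g, i⟩) :=
    Finset.measurable_prod _ fun g _ => Finset.measurable_prod _ fun i _ =>
      (Measure.measurable_coe (hA ⟨g, i⟩)).comp (measurable_pi_apply g)
  have hlaw : ∫⁻ q, ∏ g, ∏ i, q g (A ⟨g, i⟩) ∂P.map p
      = ∫⁻ x, ∏ g, ∏ i, construct ℓ x g (A ⟨g, i⟩) ∂inputLaw α P₀ := by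
    rw [hp.map_eq]
    exact lintegral_map hF (measurable_construct ℓ)
  rw [hset]
  refine h.trans ((lintegral_map' hF.aemeasurable hp.aemeasurable).symm.trans (hlaw.trans ?_))
  refine lintegral_congr fun x => ?_
  rw [Fintype.prod_sigma]
  refine Finset.prod_congr rfl fun g _ => Finset.prod_congr rfl fun i _ => ?_
  exact construct_apply ℓ x g (hA _)

/-- Given the weights and distinct atoms, the expected number of distinct observations. -/
lemma tsum_prod_weight_mul_ncard_range {Θ : Type*} {G : ℕ} (u n : Fin G → ℕ) {v : ℕ → ℝ}
    (hv : ∀ j, v j ∈ Set.Icc (0 : ℝ) 1)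
    (hone : ∀ g, ∑' k, ENNReal.ofReal (weight (fun j => decide (u g + 1 ≤ j + 1)) v k) = 1)
    {θ : ℕ → Θ} (hθ : Function.Injective θ) :
    ∑' j : (Σ g, Fin (n g)) → ℕ,
        (∏ i, ENNReal.ofReal (weight (fun j => decide (u i.1 + 1 ≤ j + 1)) v (j i))) *
        ((Set.range fun i => θ (j i)).ncard : ℝ≥0∞)
      = ∑' k, ENNReal.ofReal
        (1 - ∏ g, (1 - weight (fun j => decide (u g + 1 ≤ j + 1)) v k) ^ n g) := by
  have hr : ∀ j : (Σ g, Fin (n g)) → ℕ,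
      (Set.range fun i => θ (j i)).ncard = (Set.range j).ncard := fun j => by
    rw [show (fun i => θ (j i)) = θ ∘ j from rfl, Set.range_comp,
      Set.ncard_image_of_injective _ hθ]
  simp_rw [hr]
  rw [tsum_prod_mul_ncard_range (ι := Σ g, Fin (n g))
    (fun i k => ENNReal.ofReal (weight (fun j => decide (u i.1 + 1 ≤ j + 1)) v k))
    fun i => hone i.1]
  refine tsum_congr fun k => ?_
  have hw : ∀ g, 0 ≤ 1 - weight (fun j => decide (u g + 1 ≤ j + 1)) v k := fun g => by
    linarith [(weight_mem_Icc hv (u g) k).2]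
  rw [ENNReal.ofReal_sub _ (Finset.prod_nonneg fun g _ => pow_nonneg (hw g) _),
    ENNReal.ofReal_one, ENNReal.ofReal_prod_of_nonneg fun g _ => pow_nonneg (hw g) _,
    Fintype.prod_sigma]
  congr 1
  refine Finset.prod_congr rfl fun g _ => ?_
  rw [ENNReal.ofReal_pow (hw g), ENNReal.ofReal_sub _ (weight_mem_Icc hv (u g) k).1,
    ENNReal.ofReal_one]
  simp

/-- Working in `[0, ∞]` allows sum and integral to be exchanged before integrability of the count is
known. -/
lemma lintegral_numDistinct {Ω Θ : Type*} [MeasurableSpace Ω] [MeasurableSpace Θ] [MeasurableEq Θ]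
    {P : Measure Ω} [IsProbabilityMeasure P] {P₀ : Measure Θ} [IsProbabilityMeasure P₀]
    (hP₀ : ∀ x : Θ, P₀ {x} = 0) (hα : 0 < α) {G : ℕ} {u n : Fin G → ℕ}
    {p : Ω → Fin G → Measure Θ}
    (hp : HasLaw p (eventuallySingleAtomLaw α P₀ fun g => u g + 1) P)
    {y : (g : Fin G) → Fin (n g) → Ω → Θ} (hy : IsConditionallyIIDSample P p n y) :
    ∫⁻ ω, (numDistinct fun g i => y g i ω : ℝ≥0∞) ∂P
      = ∑' k, ∫⁻ v, ENNReal.ofReal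
        (1 - ∏ g, (1 - weight (fun j => decide (u g + 1 ≤ j + 1)) v k) ^ n g) ∂stickLaw α := by
  have := isProbabilityMeasure_stickLaw hα
  have hw : ∀ (i : Σ g, Fin (n g)) (k : ℕ), Measurable fun x : (ℕ → ℝ) × (ℕ → Θ) =>
      ENNReal.ofReal (weight (eventualThinning (fun g => u g + 1) i.1) x.1 k) :=
    fun i k => by fun_prop
  have hθ : ∀ k : ℕ, Measurable fun x : (ℕ → ℝ) × (ℕ → Θ) => x.2 k := fun k => by fun_prop
  have hcard : Measurable fun z : (Σ g, Fin (n g)) → Θ => ((Set.range z).ncard : ℝ≥0∞) :=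
    (measurable_from_top (f := fun m : ℕ => (m : ℝ≥0∞))).comp measurable_ncard_range
  have hmix := lintegral_of_discrete_mixture hw hθ
    (fun i : Σ g, Fin (n g) => hy.measurable i.1 i.2)
    (IsConditionallyIIDSample.measure_forall_mem hp hy) hcard
  simp_rw [numDistinct_eq_ncard_range]
  refine hmix.trans ?_
  have hfst := Measure.quasiMeasurePreserving_fst (μ := stickLaw α)
    (ν := Measure.infinitePi fun _ : ℕ => P₀)
  have hsnd := Measure.quasiMeasurePreserving_snd (μ := stickLaw α)
    (ν := Measure.infinitePi fun _ : ℕ => P₀)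
  have hone := hfst.ae (ae_all_iff.2 fun g => ae_tsum_weight_eq_one hα (u g))
  have hunit := hfst.ae (ae_stickLaw_mem_Icc hα)
  have hinj := hsnd.ae (ae_injective_infinitePi hP₀)
  have hm : ∀ k, Measurable fun v : ℕ → ℝ => ENNReal.ofReal
      (1 - ∏ g, (1 - weight (fun j => decide (u g + 1 ≤ j + 1)) v k) ^ n g) :=
    fun k => by fun_prop
  rw [← lintegral_tsum fun k => (hm k).aemeasurable]
  refine Eq.trans (lintegral_congr_ae ?_) ((measurePreserving_fst (μ := stickLaw α)
    (ν := Measure.infinitePi fun _ : ℕ => P₀)).lintegral_comp (Measurable.tsum hm))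
  filter_upwards [hone, hunit, hinj] with x h1 h2 h3
  exact tsum_prod_weight_mul_ncard_range u n h2 h1 h3

end NumDistinct

end ThinnedDDP

/-! ### The expectation formula -/

theorem proposition3 {Ω Θ : Type*} [MeasurableSpace Ω] [MeasurableSpace Θ] [MeasurableEq Θ]
    (P : Measure Ω) [IsProbabilityMeasure P]
    (P₀ : Measure Θ) [IsProbabilityMeasure P₀] (hP₀ : ∀ x : Θ, P₀ {x} = 0)
    (α : ℝ) (hα : 0 < α)
    (u₁ u₂ : ℕ) (hu₁ : 1 ≤ u₁) (hu : u₁ ≤ u₂) (n₁ n₂ : ℕ)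
    (p : Ω → Fin 2 → Measure Θ)
    (hp : HasLaw p (ThinnedDDP.eventuallySingleAtomLaw α P₀ ![u₁, u₂]) P)
    (y : (g : Fin 2) → Fin (![n₁, n₂] g) → Ω → Θ)
    (hy : ThinnedDDP.IsConditionallyIIDSample P p ![n₁, n₂] y) :
    Integrable (fun ω => (ThinnedDDP.numDistinct (fun g i => y g i ω) : ℝ)) P ∧
    ∫ ω, (ThinnedDDP.numDistinct (fun g i => y g i ω) : ℝ) ∂P =
      (∑ r ∈ Finset.Icc 1 n₁, (-1 : ℝ) ^ (r - 1) * (n₁.choose r : ℝ) *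
        (Real.Gamma (α + 1) * Real.Gamma (r : ℝ) / Real.Gamma (α + (r : ℝ))) *
        (1 - (α / (α + (r : ℝ))) ^ (u₂ - u₁))) +
      ∑ r ∈ Finset.range (n₁ + 1), (n₁.choose r : ℝ) *
        (∑ i ∈ Finset.Icc 1 (n₂ + n₁ - r), α / (α + (i : ℝ) - 1)) *
        ∑ l ∈ Finset.range (r + 1), (-1 : ℝ) ^ l * (r.choose l : ℝ) *
          (α / (α + (l : ℝ) + (n₁ : ℝ) - (r : ℝ))) ^ (u₂ - u₁) := by
  obtain ⟨a, rfl⟩ : ∃ a, u₁ = a + 1 := ⟨u₁ - 1, by omega⟩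
  obtain ⟨d, rfl⟩ : ∃ d, u₂ = a + d + 1 := ⟨u₂ - (a + 1), by omega⟩
  rw [show a + d + 1 - (a + 1) = d by omega]
  have hu' : ![a + 1, a + d + 1] = fun g => ![a, a + d] g + 1 := by
    funext g; fin_cases g <;> rfl
  rw [hu'] at hp
  have hsum := ThinnedDDP.hasSum_integral_one_sub_weight hα a d n₁ n₂
  have hlint : ∫⁻ ω, (ThinnedDDP.numDistinct fun g i => y g i ω : ENNReal) ∂P
      = ∑' k, ∫⁻ v, ENNReal.ofReal
        (1 - (1 - ThinnedDDP.weight (fun j => decide (a + 1 ≤ j + 1)) v k) ^ n₁ *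
          (1 - ThinnedDDP.weight (fun j => decide (a + d + 1 ≤ j + 1)) v k) ^ n₂)
        ∂ThinnedDDP.stickLaw α := by
    have h := ThinnedDDP.lintegral_numDistinct hP₀ hα hp hy
    simp_rw [Fin.prod_univ_two] at h
    exact h
  have hmem : ∀ k (v : ℕ → ℝ), (∀ j, v j ∈ Set.Icc (0 : ℝ) 1) →
      1 - (1 - ThinnedDDP.weight (fun j => decide (a + 1 ≤ j + 1)) v k) ^ n₁ *
        (1 - ThinnedDDP.weight (fun j => decide (a + d + 1 ≤ j + 1)) v k) ^ n₂
      ∈ Set.Icc (0 : ℝ) 1 := fun k v hv =>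
    ThinnedDDP.one_sub_mem_unit (ThinnedDDP.mul_mem_unit
      (ThinnedDDP.pow_mem_unit (ThinnedDDP.one_sub_mem_unit (ThinnedDDP.weight_mem_Icc hv _ k)) _)
      (ThinnedDDP.pow_mem_unit (ThinnedDDP.one_sub_mem_unit (ThinnedDDP.weight_mem_Icc hv _ k)) _))
  have hnn := fun k => (ThinnedDDP.ae_stickLaw_mem_Icc hα).mono fun v hv => (hmem k v hv).1
  have hint := fun k => ThinnedDDP.integrable_of_bounded_on_unit hα (by fun_prop) 1 fun v hv =>
    ThinnedDDP.abs_le_one_of_mem_Icc (hmem k v hv)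
  have hterm := fun k => (ofReal_integral_eq_lintegral_ofReal (hint k) (hnn k)).symm
  -- The series converges to a real number, so this one identity yields both integrability and the
  -- value.
  rw [tsum_congr hterm, ← ENNReal.ofReal_tsum_of_nonneg
    (fun k => integral_nonneg_of_ae (hnn k)) hsum.summable, hsum.tsum_eq] at hlint
  have hS := hsum.nonneg fun k => integral_nonneg_of_ae (hnn k)
  have hmeas : Measurable fun ω => (ThinnedDDP.numDistinct (fun g i => y g i ω) : ℝ) :=
    measurable_from_top.comp (ThinnedDDP.measurable_numDistinct hy.measurable)
  simp_rw [← ENNReal.ofReal_natCast] at hlint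
  refine ⟨⟨hmeas.aestronglyMeasurable, ?_⟩, ?_⟩
  · rw [hasFiniteIntegral_iff_ofReal (ae_of_all _ fun _ => Nat.cast_nonneg _), hlint]
    exact ENNReal.ofReal_lt_top
  · rw [integral_eq_lintegral_of_nonneg_ae (ae_of_all _ fun _ => Nat.cast_nonneg _)
      hmeas.aestronglyMeasurable, hlint, ENNReal.toReal_ofReal hS]
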